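/- **Proposition 5.4.** Let $A=A^T\in\mathbb R^{n\times n}$, $b,x_0\in\mathbb R^n$, let $m\ge 2$ and $j\ge 0$ be integers, and put $r_0=b-Ax_0$. DIOM($m$) starts from $v_1=r_0/\|r_0\|_2$, $\zeta_1=\|r_0\|_2$ and performs, for $k=1,2,\dots$, with $m_k=\max(1,k-m+1)$: 1. $w\leftarrow Av_k$; for $i=m_k,\dots,k$: $t_{i,k}=v_i^Tw$, $w\leftarrow w-t_{i,k}v_i$; then $t_{k+1,k}=\|w\|_2$ and $v_{k+1}=w/t_{k+1,k}$; 2. for $i=m_k,\dots,k$: $u_{i,k}=t_{i,k}-\ell_{i,i-1}u_{i-1,k}$ (just $u_{1,k}=t_{1,k}$ if $i=1$; entries $u_{i,k}$ with $i<m_k$ are $0$); 3. $p_k=\bigl(v_k-\sum_{i=m_k}^{k-1}u_{i,k}p_i\bigr)/u_{k,k}$, $\quad x_k^{\mathrm{DIOM}}=x_{k-1}^{\mathrm{DIOM}}+\zeta_kp_k$ (with $x_0^{\mathrm{DIOM}}=x_0$), $\quad\ell_{k+1,k}=t_{k+1,k}/u_{k,k}$, $\quad\zeta_{k+1}=-\ell_{k+1,k}\zeta_k$.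 Let $T_k=(t_{i,l})_{1\le i,l\le k}$, the entries not computed above being $0$; it is banded upper Hessenberg. Suppose that DIOM($m$) is well defined for $k=1,\dots,j$, in the sense that $v_1,\dots,v_j$ exist (no division by zero in forming them; $t_{j+1,j}=0$ is allowed) and each $T_k$, $k=1,\dots,j$, is nonsingular. Let $x_k^{\mathrm{CG}}$ be the iterates of the unpreconditioned conjugate gradient method from the same $x_0$: $g_0=Ax_0-b$, $d_0=-g_0$, and $$\alpha_k=\frac{g_k^Tg_k}{d_k^TAd_k},\quad x_{k+1}^{\mathrm{CG}}=x_k^{\mathrm{CG}}+\alpha_kd_k,\quad g_{k+1}=g_k+\alpha_kAd_k,\quad d_{k+1}=-g_{k+1}+\frac{g_{k+1}^Tg_{k+1}}{g_k^Tg_k}\,d_k .$$ Then the conjugate gradient iterations $k=0,\dots,j-1$ are well defined, i.e. $g_k^Tg_k\ne0$ and $d_k^TAd_k\neq 0$ for $0\le k<j$, and $$x_k^{\mathrm{DIOM}}=x_k^{\mathrm{CG}}\qquad(k=0,1,\dots,j).$$ -/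

import Mathlib

/-!
Vectors live in `EuclideanSpace ℝ (Fin n)`, so `‖·‖` is the 2-norm, `inner ℝ v w` is `vᵀ w`, and
`A.toEuclideanLin v` is the matrix-vector product `A v`.
-/

noncomputable section

open Finset

namespace Krylov

variable {n : ℕ}

/-! ### The preconditioned conjugate gradient method -/

/-- The vectors carried from one PCG iteration to the next: the iterate, the gradient of
`q(x) = ½ xᵀ A x - bᵀ x` at the iterate, and the search direction. -/
structure PCGState (n : ℕ) where
  x : EuclideanSpace ℝ (Fin n)
  g : EuclideanSpace ℝ (Fin n)
  d : EuclideanSpace ℝ (Fin n)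

/-- The scalar `ρ = gᵀ H₀ g`. -/
def PCGState.rho (H₀ : Matrix (Fin n) (Fin n) ℝ) (s : PCGState n) : ℝ :=
  inner ℝ s.g (H₀.toEuclideanLin s.g)

/-- The curvature `dᵀ A d` along the search direction. -/
def PCGState.curv (A : Matrix (Fin n) (Fin n) ℝ) (s : PCGState n) : ℝ :=
  inner ℝ s.d (A.toEuclideanLin s.d)

/-- Start of PCG: `g₀ = A x₀ - b`, `d₀ = -H₀ g₀`. -/
def pcgInit (A H₀ : Matrix (Fin n) (Fin n) ℝ) (b x₀ : EuclideanSpace ℝ (Fin n)) : PCGState n where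
  x := x₀
  g := A.toEuclideanLin x₀ - b
  d := -H₀.toEuclideanLin (A.toEuclideanLin x₀ - b)

/-- One PCG iteration. -/
def pcgStep (A H₀ : Matrix (Fin n) (Fin n) ℝ) (s : PCGState n) : PCGState n :=
  let α : ℝ := s.rho H₀ / s.curv A
  let g' := s.g + α • A.toEuclideanLin s.d
  let β : ℝ := inner ℝ g' (H₀.toEuclideanLin g') / s.rho H₀
  { x := s.x + α • s.d
    g := g'
    d := -H₀.toEuclideanLin g' + β • s.d }

/-- The state `(x_k, g_k, d_k)` of PCG with preconditioner `H₀`, started at `x₀`. -/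
def pcg (A H₀ : Matrix (Fin n) (Fin n) ℝ) (b x₀ : EuclideanSpace ℝ (Fin n)) : ℕ → PCGState n
  | 0 => pcgInit A H₀ b x₀
  | k + 1 => pcgStep A H₀ (pcg A H₀ b x₀ k)

/-! ### DIOM(m)

As in the usual description of the algorithm, `v`, `p`, `ζ` and the rows and columns of `T`, `L`,
`U` are indexed from `1`; the values at index `0` are placeholders that are never used. -/

/-- `m_k = max (1, k - m + 1)`, the first index of the orthogonalization window. -/
def windowStart (m k : ℕ) : ℕ := max 1 (k + 1 - m)

/-- The inner orthogonalization loop: the vector `w` after the `l` assignments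
`w ← w - (v_iᵀ w) v_i`, `i = s, …, s + l - 1`, executed in that order. -/
def orthLoop (v : ℕ → EuclideanSpace ℝ (Fin n)) (s : ℕ) (w : EuclideanSpace ℝ (Fin n)) :
    ℕ → EuclideanSpace ℝ (Fin n)
  | 0 => w
  | l + 1 => orthLoop v s w l - (inner ℝ (v (s + l)) (orthLoop v s w l) : ℝ) • v (s + l)

/-- The loop only reads the vectors of the window. -/
theorem orthLoop_congr {v v' : ℕ → EuclideanSpace ℝ (Fin n)} {s : ℕ}
    (w : EuclideanSpace ℝ (Fin n)) (l : ℕ) (h : ∀ i, s ≤ i → i < s + l → v i = v' i) :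
    orthLoop v s w l = orthLoop v' s w l := by
  induction l with
  | zero => rfl
  | succ l ih =>
    simp only [orthLoop]
    rw [ih (fun i h1 h2 => h i h1 (by omega)), h (s + l) (by omega) (by omega)]

/-- The basis vectors `v_k` of the incomplete orthogonalization process: `v₁ = r₀ / ‖r₀‖` with
`r₀ = b - A x₀`, and `v_{k+1} = w / ‖w‖`, where `w` is `A v_k` after orthogonalization against
`v_i`, `i = m_k, …, k`. If the process breaks down (`r₀ = 0` or `w = 0`) the next vector is `0`. -/
def diomV (A : Matrix (Fin n) (Fin n) ℝ) (b x₀ : EuclideanSpace ℝ (Fin n)) (m : ℕ) :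
    ℕ → EuclideanSpace ℝ (Fin n)
  | 0 => 0
  | 1 => ‖b - A.toEuclideanLin x₀‖⁻¹ • (b - A.toEuclideanLin x₀)
  | k + 2 =>
    let w := orthLoop (fun i => if _h : i ≤ k + 1 then diomV A b x₀ m i else 0)
      (windowStart m (k + 1)) (A.toEuclideanLin (diomV A b x₀ m (k + 1)))
      (k + 2 - windowStart m (k + 1))
    ‖w‖⁻¹ • w
  termination_by k => k
  decreasing_by all_goals omega

section

variable (A : Matrix (Fin n) (Fin n) ℝ) (b x₀ : EuclideanSpace ℝ (Fin n)) (m : ℕ)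

/-- The vector `w` of iteration `k` after the first `l` passes of the orthogonalization loop. -/
def diomW (k l : ℕ) : EuclideanSpace ℝ (Fin n) :=
  orthLoop (diomV A b x₀ m) (windowStart m k) (A.toEuclideanLin (diomV A b x₀ m k)) l

/-- The vector `w` of iteration `k` at the end of the loop over `i = m_k, …, k`. -/
def diomWEnd (k : ℕ) : EuclideanSpace ℝ (Fin n) :=
  diomW A b x₀ m k (k + 1 - windowStart m k)

/-- The defining recursion of the basis vectors. -/
theorem diomV_succ (k : ℕ) (hk : 1 ≤ k) :
    diomV A b x₀ m (k + 1) = ‖diomWEnd A b x₀ m k‖⁻¹ • diomWEnd A b x₀ m k := by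
  obtain ⟨k, rfl⟩ : ∃ k', k = k' + 1 := ⟨k - 1, by omega⟩
  have hs : windowStart m (k + 1) ≤ k + 2 := by unfold windowStart; omega
  have h : orthLoop (fun i => if _h : i ≤ k + 1 then diomV A b x₀ m i else 0)
      (windowStart m (k + 1)) (A.toEuclideanLin (diomV A b x₀ m (k + 1)))
      (k + 2 - windowStart m (k + 1)) = diomWEnd A b x₀ m (k + 1) := by
    apply orthLoop_congr
    intro i _ h2
    have : i ≤ k + 1 := by omega
    simp [this]
  rw [diomV]
  simp only [h]

/-- The coefficients `t_{i,k}`: `t_{i,k} = v_iᵀ w` inside the window `m_k ≤ i ≤ k`, with `w` the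
current vector of the loop; `t_{k+1,k} = ‖w‖` at the end of the loop; all others vanish. -/
def diomT (i k : ℕ) : ℝ :=
  if windowStart m k ≤ i ∧ i ≤ k then
    inner ℝ (diomV A b x₀ m i) (diomW A b x₀ m k (i - windowStart m k))
  else if i = k + 1 then ‖diomWEnd A b x₀ m k‖
  else 0

/-- The `k × k` banded upper Hessenberg matrix `T_k = (t_{i,l})`, `1 ≤ i, l ≤ k`. -/
def diomTMatrix (k : ℕ) : Matrix (Fin k) (Fin k) ℝ :=
  Matrix.of fun i l => diomT A b x₀ m (i + 1) (l + 1)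

/-- The entries `u_{i,k}` of the upper triangular factor: `u_{1,k} = t_{1,k}` and
`u_{i,k} = t_{i,k} - ℓ_{i,i-1} u_{i-1,k}` with `ℓ_{i,i-1} = t_{i,i-1} / u_{i-1,i-1}`, for
`m_k ≤ i ≤ k`; the entries outside this range vanish. -/
def diomU : ℕ → ℕ → ℝ
  | 0, _ => 0
  | 1, k => if windowStart m k ≤ 1 ∧ 1 ≤ k then diomT A b x₀ m 1 k else 0
  | i + 2, k =>
    if windowStart m k ≤ i + 2 ∧ i + 2 ≤ k then
      diomT A b x₀ m (i + 2) k -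
        diomT A b x₀ m (i + 2) (i + 1) / diomU (i + 1) (i + 1) * diomU (i + 1) k
    else 0

/-- The subdiagonal entry `ℓ_{k+1,k} = t_{k+1,k} / u_{k,k}` of the unit lower bidiagonal factor. -/
def diomL (k : ℕ) : ℝ := diomT A b x₀ m (k + 1) k / diomU A b x₀ m k k

/-- `ζ₁ = β = ‖r₀‖` and `ζ_{k+1} = -ℓ_{k+1,k} ζ_k`. -/
def diomZeta : ℕ → ℝ
  | 0 => 0
  | 1 => ‖b - A.toEuclideanLin x₀‖
  | k + 2 => -diomL A b x₀ m (k + 1) * diomZeta (k + 1)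

end

/-- The directions `p_k = (v_k - ∑_{i = m_k}^{k-1} u_{i,k} p_i) / u_{k,k}`. -/
def diomP (A : Matrix (Fin n) (Fin n) ℝ) (b x₀ : EuclideanSpace ℝ (Fin n)) (m k : ℕ) :
    EuclideanSpace ℝ (Fin n) :=
  (diomU A b x₀ m k k)⁻¹ • (diomV A b x₀ m k -
    ∑ i ∈ (Ico (windowStart m k) k).attach, diomU A b x₀ m i k • diomP A b x₀ m i)
  termination_by k
  decreasing_by exact (Finset.mem_Ico.mp i.2).2

/-- The recursion of the directions. -/
theorem diomP_eq (A : Matrix (Fin n) (Fin n) ℝ) (b x₀ : EuclideanSpace ℝ (Fin n)) (m k : ℕ) :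
    diomP A b x₀ m k = (diomU A b x₀ m k k)⁻¹ • (diomV A b x₀ m k -
      ∑ i ∈ Ico (windowStart m k) k, diomU A b x₀ m i k • diomP A b x₀ m i) := by
  rw [diomP]
  congr 2
  exact Finset.sum_attach (Ico (windowStart m k) k)
    (fun i => diomU A b x₀ m i k • diomP A b x₀ m i)

/-- The DIOM(m) iterates: `x_k = x_{k-1} + ζ_k p_k`. -/
def diomX (A : Matrix (Fin n) (Fin n) ℝ) (b x₀ : EuclideanSpace ℝ (Fin n)) (m : ℕ) :
    ℕ → EuclideanSpace ℝ (Fin n)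
  | 0 => x₀
  | k + 1 => diomX A b x₀ m k + diomZeta A b x₀ m (k + 1) • diomP A b x₀ m (k + 1)

/-- DIOM(m) is well defined for `k = 1, …, j`: each `T_k` is nonsingular. This includes that the
vectors `v_1, …, v_j` exist: a breakdown (`r₀ = 0`, or `w = 0` at some iteration `k < j`) gives a
zero vector by the convention in `diomV`, hence a zero column in the next matrix `T`. -/
def DIOMWellDefined (A : Matrix (Fin n) (Fin n) ℝ) (b x₀ : EuclideanSpace ℝ (Fin n))
    (m j : ℕ) : Prop :=
  ∀ k, 1 ≤ k → k ≤ j → IsUnit (diomTMatrix A b x₀ m k)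

end Krylov

end

/-!
The proof identifies DIOM(`m`) for symmetric `A` with the Lanczos process, and the Lanczos process
with conjugate gradients.

For symmetric `A`, orthogonalizing `A v_k` against `v_{k-1}` and `v_k` only (hence against any
window with `m ≥ 2`) already makes it orthogonal to all earlier basis vectors: if `i < k - 1`, then
`v_iᵀ A v_k = (A v_i)ᵀ v_k` vanishes because `A v_i` lies in the span of `v_1, …, v_{i+1}`
(`orthonormal_diomV`). Consequently `t_{i,k} = v_iᵀ A v_k`, the matrix `T_k` is symmetric
tridiagonal (`diomT_eq_zero`, `diomT_symm`), and the directions satisfy the two-term recursion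
`u_{k,k} p_k = v_k - t_{k,k-1} p_{k-1}` (`diomU_smul_diomP_succ`).

The numbers `u_{i,k}` and `ℓ_{k+1,k}` are the entries of an LU factorization of `T_k` without
pivoting (`diomTMatrix_eq_mul`), so nonsingularity of all `T_k` means that no pivot `u_{k,k}`
vanishes (`diomU_self_ne_zero`). From this one gets `A p_k = v_k + ℓ_{k+1,k} v_{k+1}`
(`toEuclideanLin_diomP`) and `p_kᵀ A p_k = 1 / u_{k,k}`.

With these relations an induction on `k` shows that the conjugate gradient quantities are
`g_k = -ζ_{k+1} v_{k+1}` and `d_k = ζ_{k+1} u_{k+1,k+1} p_{k+1}`. Hence `g_kᵀ g_k = ζ_{k+1}²` and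
`d_kᵀ A d_k = ζ_{k+1}² u_{k+1,k+1}`, both nonzero, and `α_k d_k = ζ_{k+1} p_{k+1}`, so that the two
methods make the same steps.
-/

noncomputable section

open Finset

namespace Krylov

variable {n : ℕ}

/-! ### The incomplete orthogonalization process -/

theorem orthLoop_zero_right (v : ℕ → EuclideanSpace ℝ (Fin n)) (s l : ℕ) :
    orthLoop v s 0 l = 0 := by
  induction l with
  | zero => rfl
  | succ l ih => simp [orthLoop, ih]

section

variable (A : Matrix (Fin n) (Fin n) ℝ) (b x₀ : EuclideanSpace ℝ (Fin n)) (m : ℕ)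

theorem one_le_windowStart (k : ℕ) : 1 ≤ windowStart m k := le_max_left _ _

variable {m} in
/-- A window with `m ≥ 2` contains at least the two most recent indices. -/
theorem windowStart_succ_le (hm : 2 ≤ m) {k : ℕ} (hk : 1 ≤ k) : windowStart m (k + 1) ≤ k := by
  unfold windowStart; omega

theorem diomT_of_mem {i k : ℕ} (h₁ : windowStart m k ≤ i) (h₂ : i ≤ k) :
    diomT A b x₀ m i k =
      inner ℝ (diomV A b x₀ m i) (diomW A b x₀ m k (i - windowStart m k)) := by
  rw [diomT, if_pos ⟨h₁, h₂⟩]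

theorem diomT_succ_self (k : ℕ) : diomT A b x₀ m (k + 1) k = ‖diomWEnd A b x₀ m k‖ := by
  rw [diomT, if_neg (by omega), if_pos rfl]

theorem diomW_eq (k l : ℕ) (hl : windowStart m k + l ≤ k + 1) :
    diomW A b x₀ m k l = A.toEuclideanLin (diomV A b x₀ m k) -
      ∑ i ∈ Ico (windowStart m k) (windowStart m k + l),
        diomT A b x₀ m i k • diomV A b x₀ m i := by
  induction l with
  | zero => simp [diomW, orthLoop]
  | succ l ih =>
    have hT := diomT_of_mem A b x₀ m (i := windowStart m k + l) (k := k) (by omega) (by omega)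
    rw [Nat.add_sub_cancel_left] at hT
    rw [← add_assoc, Finset.sum_Ico_succ_top (by omega), ← sub_sub, ← ih (by omega), hT]
    rfl

/-- The vector normalized to `v_{k+1}` is `t_{k+1,k} v_{k+1}`, also when it is zero. -/
theorem diomWEnd_eq_smul {k : ℕ} (hk : 1 ≤ k) :
    diomWEnd A b x₀ m k = diomT A b x₀ m (k + 1) k • diomV A b x₀ m (k + 1) := by
  rw [diomV_succ A b x₀ m k hk, diomT_succ_self, smul_smul]
  by_cases h : diomWEnd A b x₀ m k = 0
  · simp [h]
  · rw [mul_inv_cancel₀ (norm_ne_zero_iff.2 h), one_smul]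

/-- The Arnoldi relation `A V_k = V_{k+1} T̄_k`, column by column. It holds without any
orthogonality of the basis vectors, as it only records the operations of the loop. -/
theorem toEuclideanLin_diomV {k : ℕ} (hk : 1 ≤ k) :
    A.toEuclideanLin (diomV A b x₀ m k) =
      diomT A b x₀ m (k + 1) k • diomV A b x₀ m (k + 1) +
        ∑ i ∈ Ico (windowStart m k) (k + 1), diomT A b x₀ m i k • diomV A b x₀ m i := by
  have hs : windowStart m k ≤ k + 1 := by unfold windowStart; omega
  have h := diomW_eq A b x₀ m k (k + 1 - windowStart m k) (by omega)
  rw [Nat.add_sub_cancel' (by omega)] at h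
  rw [← diomWEnd_eq_smul A b x₀ m hk, diomWEnd, h, sub_add_cancel]

theorem diomV_eq_normalized {k : ℕ} (hk : 1 ≤ k) :
    ∃ w : EuclideanSpace ℝ (Fin n), diomV A b x₀ m k = ‖w‖⁻¹ • w := by
  obtain _ | _ | k := k
  · omega
  · exact ⟨_, by rw [zero_add, diomV]⟩
  · exact ⟨_, diomV_succ A b x₀ m (k + 1) (by omega)⟩

variable {A b x₀ m}

/-- A breakdown before step `k` makes the last column of `T_k` vanish. -/
theorem diomV_ne_zero {k : ℕ} (hk : 1 ≤ k) (hT : IsUnit (diomTMatrix A b x₀ m k)) :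
    diomV A b x₀ m k ≠ 0 := by
  intro h0
  have hW : ∀ l, diomW A b x₀ m k l = 0 := fun l => by
    rw [diomW, h0, map_zero, orthLoop_zero_right]
  rw [Matrix.isUnit_iff_isUnit_det, Matrix.det_eq_zero_of_column_eq_zero ⟨k - 1, by omega⟩] at hT
  · exact not_isUnit_zero hT
  · intro i
    have hk' : k - 1 + 1 = k := by omega
    simp [diomTMatrix, hk', diomT, diomWEnd, hW]

theorem norm_diomV {k : ℕ} (hk : 1 ≤ k) (hT : IsUnit (diomTMatrix A b x₀ m k)) :
    ‖diomV A b x₀ m k‖ = 1 := by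
  have h0 := diomV_ne_zero hk hT
  obtain ⟨w, hw⟩ := diomV_eq_normalized A b x₀ m hk
  rw [hw] at h0 ⊢
  exact norm_smul_inv_norm (𝕜 := ℝ) (by rintro rfl; simp at h0)

/-! ### The Lanczos relations for symmetric matrices -/

theorem inner_toEuclideanLin_comm (hA : A.IsSymm) (v w : EuclideanSpace ℝ (Fin n)) :
    inner ℝ v (A.toEuclideanLin w) = (inner ℝ (A.toEuclideanLin v) w : ℝ) := by
  have hA' : A.IsHermitian := by
    rw [Matrix.IsHermitian, Matrix.conjTranspose_eq_transpose_of_trivial]; exact hA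
  exact ((Matrix.isSymmetric_toEuclideanLin_iff.2 hA') v w).symm

/-- As long as the basis is orthonormal, the loop (modified Gram–Schmidt) computes the same
coefficients as classical Gram–Schmidt. -/
theorem diomT_eq_inner {i k : ℕ} (h₁ : windowStart m k ≤ i) (h₂ : i ≤ k)
    (horth : ∀ a, 1 ≤ a → a < i → inner ℝ (diomV A b x₀ m a) (diomV A b x₀ m i) = (0 : ℝ)) :
    diomT A b x₀ m i k =
      inner ℝ (diomV A b x₀ m i) (A.toEuclideanLin (diomV A b x₀ m k)) := by
  have hs := one_le_windowStart m k
  rw [diomT_of_mem A b x₀ m h₁ h₂, diomW_eq A b x₀ m k _ (by omega), inner_sub_right, inner_sum,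
    Finset.sum_eq_zero, sub_zero]
  intro a ha
  rw [Finset.mem_Ico] at ha
  rw [inner_smul_right, real_inner_comm, horth a (by omega) (by omega), mul_zero]

/-- The incomplete orthogonalization is complete: for symmetric `A` and `m ≥ 2` every basis vector
is orthogonal to all its predecessors. This includes `v_{j+1}`, which may be zero. -/
theorem inner_diomV_eq_zero (hA : A.IsSymm) (hm : 2 ≤ m) {j : ℕ}
    (hwd : DIOMWellDefined A b x₀ m j) {k i : ℕ} (hk : k ≤ j + 1) (hi : 1 ≤ i) (hik : i < k) :
    inner ℝ (diomV A b x₀ m i) (diomV A b x₀ m k) = (0 : ℝ) := by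
  induction k using Nat.strong_induction_on generalizing i with
  | _ k ih =>
  obtain ⟨k, rfl⟩ : ∃ q, k = q + 1 := ⟨k - 1, by omega⟩
  have horth : ∀ a c, 1 ≤ a → 1 ≤ c → a ≤ k → c ≤ k → a ≠ c →
      inner ℝ (diomV A b x₀ m a) (diomV A b x₀ m c) = (0 : ℝ) := by
    intro a c ha hc hak hck hac
    rcases lt_or_gt_of_ne hac with h | h
    · exact ih c (by omega) (by omega) ha h
    · rw [real_inner_comm]; exact ih a (by omega) (by omega) hc h
  have hs := one_le_windowStart m k
  have hw : inner ℝ (diomV A b x₀ m i)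
      (diomT A b x₀ m (k + 1) k • diomV A b x₀ m (k + 1)) = (0 : ℝ) := by
    rw [← add_sub_cancel_right (diomT A b x₀ m (k + 1) k • diomV A b x₀ m (k + 1)) (∑ i ∈
      Ico (windowStart m k) (k + 1), diomT A b x₀ m i k • diomV A b x₀ m i),
      ← toEuclideanLin_diomV A b x₀ m (by omega), inner_sub_right, inner_sum]
    by_cases hwin : windowStart m k ≤ i
    · rw [Finset.sum_eq_single i, inner_smul_right, real_inner_self_eq_norm_sq,
        norm_diomV hi (hwd i hi (by omega)),
        diomT_eq_inner hwin (by omega) fun a h1 h2 => horth a i h1 hi (by omega) (by omega)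
          (by omega)]
      · ring
      · intro a ha hai
        rw [Finset.mem_Ico] at ha
        rw [inner_smul_right, horth i a hi (by omega) (by omega) (by omega) hai.symm, mul_zero]
      · intro h
        exact absurd (Finset.mem_Ico.2 ⟨hwin, by omega⟩) h
    · have hik1 : i + 1 < k := by
        unfold windowStart at hwin; omega
      rw [inner_toEuclideanLin_comm hA, toEuclideanLin_diomV A b x₀ m hi, inner_add_left,
        inner_smul_left, horth (i + 1) k (by omega) (by omega) (by omega) (by omega) (by omega),
        sum_inner, Finset.sum_eq_zero, Finset.sum_eq_zero]
      · simp
      · intro a ha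
        rw [Finset.mem_Ico] at ha
        rw [inner_smul_right, horth i a hi (by omega) (by omega) (by omega) (by omega), mul_zero]
      · intro a ha
        have := one_le_windowStart m i
        rw [Finset.mem_Ico] at ha
        rw [inner_smul_left, horth a k (by omega) (by omega) (by omega) (by omega) (by omega),
          mul_zero]
  rw [inner_smul_right, mul_eq_zero] at hw
  rcases hw with h0 | h
  · -- a vanishing `t_{k+1,k}` means that `v_{k+1}` is zero by convention
    rw [diomT_succ_self, norm_eq_zero] at h0
    rw [diomV_succ A b x₀ m k (by omega), h0, smul_zero, inner_zero_right]
  · exact h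

variable {j : ℕ}

theorem diomT_eq_zero (hA : A.IsSymm) (hm : 2 ≤ m) (hwd : DIOMWellDefined A b x₀ m j)
    {i k : ℕ} (hk : k ≤ j) (hi : 1 ≤ i) (hik : i + 1 < k) : diomT A b x₀ m i k = 0 := by
  by_cases hwin : windowStart m k ≤ i
  · rw [diomT_eq_inner hwin (by omega) fun a h1 h2 =>
      inner_diomV_eq_zero hA hm hwd (by omega) h1 h2, inner_toEuclideanLin_comm hA,
      toEuclideanLin_diomV A b x₀ m hi, inner_add_left, inner_smul_left,
      inner_diomV_eq_zero hA hm hwd (by omega) (by omega) hik, sum_inner, Finset.sum_eq_zero]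
    · simp
    · intro a ha
      have := one_le_windowStart m i
      rw [Finset.mem_Ico] at ha
      rw [inner_smul_left, inner_diomV_eq_zero hA hm hwd (by omega) (by omega) (by omega),
        mul_zero]
  · rw [diomT, if_neg (by omega), if_neg (by omega)]

theorem diomT_symm (hA : A.IsSymm) (hm : 2 ≤ m) (hwd : DIOMWellDefined A b x₀ m j)
    {k : ℕ} (hk : 1 ≤ k) (hkj : k + 1 ≤ j) :
    diomT A b x₀ m k (k + 1) = diomT A b x₀ m (k + 1) k := by
  have hs := one_le_windowStart m k
  rw [diomT_eq_inner (windowStart_succ_le hm hk) (by omega) fun a h1 h2 =>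
    inner_diomV_eq_zero hA hm hwd (by omega) h1 h2, inner_toEuclideanLin_comm hA,
    toEuclideanLin_diomV A b x₀ m hk, inner_add_left, inner_smul_left,
    real_inner_self_eq_norm_sq, norm_diomV (by omega) (hwd (k + 1) (by omega) hkj), sum_inner,
    Finset.sum_eq_zero]
  · simp
  · intro a ha
    rw [Finset.mem_Ico] at ha
    rw [inner_smul_left, inner_diomV_eq_zero hA hm hwd (by omega) (by omega) (by omega), mul_zero]

theorem diomT_succ_self_ne_zero (hwd : DIOMWellDefined A b x₀ m j) {k : ℕ} (hk : 1 ≤ k)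
    (hkj : k + 1 ≤ j) : diomT A b x₀ m (k + 1) k ≠ 0 := by
  intro h0
  rw [diomT_succ_self, norm_eq_zero] at h0
  refine diomV_ne_zero (by omega) (hwd (k + 1) (by omega) hkj) ?_
  rw [diomV_succ A b x₀ m k hk, h0, smul_zero]

/-! ### The LU factorization -/

theorem diomU_eq_zero {i k : ℕ} (h : ¬ (windowStart m k ≤ i ∧ i ≤ k)) :
    diomU A b x₀ m i k = 0 := by
  obtain _ | _ | i := i
  · simp [diomU]
  · simp only [zero_add] at h ⊢
    rw [diomU, if_neg h]
  · rw [diomU, if_neg h]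

theorem diomU_one {k : ℕ} (h : windowStart m k ≤ 1 ∧ 1 ≤ k) :
    diomU A b x₀ m 1 k = diomT A b x₀ m 1 k := by
  rw [diomU, if_pos h]

theorem diomU_succ {i k : ℕ} (hi : 1 ≤ i) (h : windowStart m k ≤ i + 1 ∧ i + 1 ≤ k) :
    diomU A b x₀ m (i + 1) k =
      diomT A b x₀ m (i + 1) k - diomL A b x₀ m i * diomU A b x₀ m i k := by
  obtain ⟨i, rfl⟩ : ∃ q, i = q + 1 := ⟨i - 1, by omega⟩
  rw [diomU, if_pos h, diomL]

theorem diomT_one {k : ℕ} (hk : 1 ≤ k) : diomT A b x₀ m 1 k = diomU A b x₀ m 1 k := by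
  by_cases h : windowStart m k ≤ 1
  · rw [diomU_one ⟨h, hk⟩]
  · rw [diomU_eq_zero (by omega), diomT, if_neg (by omega), if_neg (by omega)]

/-- Entrywise form of `T = L U`, valid outside the window and below the diagonal as well. -/
theorem diomT_eq_diomU_add {i k : ℕ} (hi : 1 ≤ i) (hk : 1 ≤ k)
    (hu : i = k → diomU A b x₀ m k k ≠ 0) :
    diomT A b x₀ m (i + 1) k =
      diomU A b x₀ m (i + 1) k + diomL A b x₀ m i * diomU A b x₀ m i k := by
  by_cases h : windowStart m k ≤ i + 1 ∧ i + 1 ≤ k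
  · rw [diomU_succ hi h]; ring
  · rw [diomU_eq_zero h]
    by_cases hik : i = k
    · subst hik
      rw [diomL, div_mul_cancel₀ _ (hu rfl), zero_add]
    · rw [diomU_eq_zero (by omega), diomT, if_neg h, if_neg (by omega)]
      ring

variable (A b x₀ m) in
/-- The unit lower bidiagonal factor of `T_k`. The row and column of index `i : Fin k` carry the
index `i + 1` of the algorithm. -/
def diomLMatrix (k : ℕ) : Matrix (Fin k) (Fin k) ℝ :=
  Matrix.of fun i l => (if l = i then 1 else 0) + if l.val + 1 = i.val then diomL A b x₀ m i else 0

variable (A b x₀ m) in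
/-- The upper triangular factor of `T_k`. -/
def diomUMatrix (k : ℕ) : Matrix (Fin k) (Fin k) ℝ :=
  Matrix.of fun i l => diomU A b x₀ m (i + 1) (l + 1)

/-- `T_k = L_k U_k`. The last pivot `u_{k,k}` is not divided by within `T_k`, so only the earlier
ones have to be nonzero. -/
theorem diomTMatrix_eq_mul {k : ℕ} (hu : ∀ i, 1 ≤ i → i < k → diomU A b x₀ m i i ≠ 0) :
    diomTMatrix A b x₀ m k = diomLMatrix A b x₀ m k * diomUMatrix A b x₀ m k := by
  ext ⟨i, hi⟩ ⟨l, hl⟩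
  simp only [Matrix.mul_apply, diomTMatrix, diomLMatrix, diomUMatrix, Matrix.of_apply, add_mul,
    Finset.sum_add_distrib, ite_mul, one_mul, zero_mul, Finset.sum_ite_eq', Finset.mem_univ,
    if_true]
  obtain _ | i := i
  · simp [diomT_one]
  · rw [Finset.sum_eq_single (⟨i, by omega⟩ : Fin k)]
    · simp only [if_true]
      exact diomT_eq_diomU_add (by omega) (by omega) fun h => hu _ (by omega) (by omega)
    · rintro ⟨a, ha⟩ - hne
      rw [if_neg]
      simpa using hne
    · simp

theorem det_diomUMatrix (k : ℕ) :
    (diomUMatrix A b x₀ m k).det = ∏ i : Fin k, diomU A b x₀ m (i + 1) (i + 1) := by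
  rw [Matrix.det_of_isUpperTriangular]
  · rfl
  · intro i l (hil : l < i)
    exact diomU_eq_zero (by omega)

/-- All pivots are nonzero when all leading principal submatrices `T_k` are nonsingular. -/
theorem diomU_self_ne_zero (hwd : DIOMWellDefined A b x₀ m j) {k : ℕ} (hk : 1 ≤ k)
    (hkj : k ≤ j) : diomU A b x₀ m k k ≠ 0 := by
  induction k using Nat.strong_induction_on with
  | _ k ih =>
  have hT := hwd k hk hkj
  rw [diomTMatrix_eq_mul fun i h1 h2 => ih i h2 h1 (by omega), Matrix.isUnit_iff_isUnit_det,
    Matrix.det_mul, IsUnit.mul_iff, det_diomUMatrix, isUnit_iff_ne_zero (a := ∏ i, _),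
    Finset.prod_ne_zero_iff] at hT
  have h := hT.2 ⟨k - 1, by omega⟩ (Finset.mem_univ _)
  rwa [show k - 1 + 1 = k by omega] at h

/-! ### The directions -/

theorem diomU_eq_zero_of_lt (hA : A.IsSymm) (hm : 2 ≤ m) (hwd : DIOMWellDefined A b x₀ m j)
    {i k : ℕ} (hk : k ≤ j) (hik : i + 1 < k) : diomU A b x₀ m i k = 0 := by
  induction i with
  | zero => simp [diomU]
  | succ i ih =>
    by_cases h : windowStart m k ≤ i + 1 ∧ i + 1 ≤ k
    · have hT := diomT_eq_zero hA hm hwd hk (by omega : 1 ≤ i + 1) hik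
      obtain _ | i := i
      · rw [zero_add, diomU_one h, hT]
      · rw [diomU_succ (by omega) h, ih (by omega), hT, mul_zero, sub_zero]
    · exact diomU_eq_zero h

/-- The superdiagonal of `U` is that of the tridiagonal matrix `T`. -/
theorem diomU_superdiag (hA : A.IsSymm) (hm : 2 ≤ m) (hwd : DIOMWellDefined A b x₀ m j)
    {k : ℕ} (hk : 1 ≤ k) (hkj : k + 1 ≤ j) :
    diomU A b x₀ m k (k + 1) = diomT A b x₀ m (k + 1) k := by
  have hs := windowStart_succ_le hm hk
  rw [← diomT_symm hA hm hwd hk hkj]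
  obtain _ | _ | k := k
  · omega
  · exact diomU_one ⟨hs, by omega⟩
  · rw [diomU_succ (by omega) ⟨hs, by omega⟩, diomU_eq_zero_of_lt hA hm hwd hkj (by omega),
      mul_zero, sub_zero]

theorem diomU_smul_diomP_one (hwd : DIOMWellDefined A b x₀ m j) (hj : 1 ≤ j) :
    diomU A b x₀ m 1 1 • diomP A b x₀ m 1 = diomV A b x₀ m 1 := by
  have hs := one_le_windowStart m 1
  rw [diomP_eq, smul_inv_smul₀ (diomU_self_ne_zero hwd le_rfl hj), Finset.Ico_eq_empty (by omega),
    Finset.sum_empty, sub_zero]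

/-- Two-term recursion of the directions. -/
theorem diomU_smul_diomP_succ (hA : A.IsSymm) (hm : 2 ≤ m) (hwd : DIOMWellDefined A b x₀ m j)
    {k : ℕ} (hk : 1 ≤ k) (hkj : k + 1 ≤ j) :
    diomU A b x₀ m (k + 1) (k + 1) • diomP A b x₀ m (k + 1) =
      diomV A b x₀ m (k + 1) - diomT A b x₀ m (k + 1) k • diomP A b x₀ m k := by
  have hs := windowStart_succ_le hm hk
  rw [diomP_eq, smul_inv_smul₀ (diomU_self_ne_zero hwd (by omega) hkj),
    Finset.sum_Ico_succ_top hs, Finset.sum_eq_zero, zero_add, diomU_superdiag hA hm hwd hk hkj]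
  intro i hi
  rw [Finset.mem_Ico] at hi
  rw [diomU_eq_zero_of_lt hA hm hwd hkj (by omega), zero_smul]

/-- The Lanczos three-term recurrence. -/
theorem toEuclideanLin_diomV_succ (hA : A.IsSymm) (hm : 2 ≤ m)
    (hwd : DIOMWellDefined A b x₀ m j) {k : ℕ} (hk : 1 ≤ k) (hkj : k + 1 ≤ j) :
    A.toEuclideanLin (diomV A b x₀ m (k + 1)) =
      diomT A b x₀ m (k + 2) (k + 1) • diomV A b x₀ m (k + 2) +
        (diomT A b x₀ m (k + 1) k • diomV A b x₀ m k +
          diomT A b x₀ m (k + 1) (k + 1) • diomV A b x₀ m (k + 1)) := by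
  have hs := windowStart_succ_le hm hk
  have hs1 := one_le_windowStart m (k + 1)
  rw [toEuclideanLin_diomV A b x₀ m (by omega), Finset.sum_Ico_succ_top (by omega),
    Finset.sum_Ico_succ_top hs, Finset.sum_eq_zero, zero_add, diomT_symm hA hm hwd hk hkj]
  intro i hi
  rw [Finset.mem_Ico] at hi
  rw [diomT_eq_zero hA hm hwd hkj (by omega) (by omega), zero_smul]

theorem diomL_mul_diomU (hwd : DIOMWellDefined A b x₀ m j) {k : ℕ} (hk : 1 ≤ k) (hkj : k ≤ j) :
    diomL A b x₀ m k * diomU A b x₀ m k k = diomT A b x₀ m (k + 1) k :=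
  div_mul_cancel₀ _ (diomU_self_ne_zero hwd hk hkj)

/-- Column `k` of `A P = V L`, which is the Arnoldi relation `A V = V L U` divided by `U`. -/
theorem toEuclideanLin_diomP (hA : A.IsSymm) (hm : 2 ≤ m) (hwd : DIOMWellDefined A b x₀ m j)
    {k : ℕ} (hk : 1 ≤ k) (hkj : k ≤ j) :
    A.toEuclideanLin (diomP A b x₀ m k) =
      diomV A b x₀ m k + diomL A b x₀ m k • diomV A b x₀ m (k + 1) := by
  have hu := diomU_self_ne_zero hwd hk hkj
  apply smul_right_injective _ hu
  simp only
  rw [← map_smul, smul_add, smul_smul, mul_comm _ (diomL A b x₀ m k), diomL_mul_diomU hwd hk hkj]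
  induction k, hk using Nat.le_induction with
  | base =>
    have hs : windowStart m 1 = 1 := by unfold windowStart; omega
    rw [diomU_smul_diomP_one hwd hkj, toEuclideanLin_diomV A b x₀ m le_rfl, hs,
      Finset.sum_Ico_succ_top le_rfl, Finset.Ico_self, Finset.sum_empty, zero_add,
      diomT_one le_rfl, add_comm]
  | succ k hk ih =>
    have hu' := diomU_self_ne_zero hwd hk (by omega)
    have hs := windowStart_succ_le hm hk
    have hA' : A.toEuclideanLin (diomP A b x₀ m k) =
        diomV A b x₀ m k + diomL A b x₀ m k • diomV A b x₀ m (k + 1) := by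
      apply smul_right_injective _ hu'
      simp only
      rw [← map_smul, ih (by omega) hu', smul_add, smul_smul, mul_comm _ (diomL A b x₀ m k),
        diomL_mul_diomU hwd hk (by omega)]
    rw [diomU_smul_diomP_succ hA hm hwd hk hkj, map_sub, map_smul, hA',
      toEuclideanLin_diomV_succ hA hm hwd hk hkj, diomU_succ hk ⟨by omega, le_rfl⟩,
      diomU_superdiag hA hm hwd hk hkj]
    module

theorem inner_diomP_diomV_eq_zero (hA : A.IsSymm) (hm : 2 ≤ m)
    (hwd : DIOMWellDefined A b x₀ m j) {k l : ℕ} (hk : 1 ≤ k) (hkl : k < l) (hkj : k ≤ j)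
    (hl : l ≤ j + 1) :
    inner ℝ (diomP A b x₀ m k) (diomV A b x₀ m l) = (0 : ℝ) := by
  have hu := diomU_self_ne_zero hwd hk hkj
  have h : inner ℝ (diomU A b x₀ m k k • diomP A b x₀ m k) (diomV A b x₀ m l) = (0 : ℝ) := by
    have hv := inner_diomV_eq_zero hA hm hwd hl hk hkl
    induction k, hk using Nat.le_induction with
    | base => rw [diomU_smul_diomP_one hwd hkj, hv]
    | succ k hk ih =>
      have hu' := diomU_self_ne_zero hwd hk (by omega)
      have := ih (by omega) (by omega) hu' (inner_diomV_eq_zero hA hm hwd hl hk (by omega))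
      rw [real_inner_smul_left, mul_eq_zero, or_iff_right hu'] at this
      rw [diomU_smul_diomP_succ hA hm hwd hk hkj, inner_sub_left, real_inner_smul_left, hv, this,
        mul_zero, sub_zero]
  rwa [real_inner_smul_left, mul_eq_zero, or_iff_right hu] at h

theorem diomU_mul_inner_diomP_diomV (hA : A.IsSymm) (hm : 2 ≤ m)
    (hwd : DIOMWellDefined A b x₀ m j) {k : ℕ} (hk : 1 ≤ k) (hkj : k ≤ j) :
    diomU A b x₀ m k k * inner ℝ (diomP A b x₀ m k) (diomV A b x₀ m k) = 1 := by
  have hv : inner ℝ (diomV A b x₀ m k) (diomV A b x₀ m k) = (1 : ℝ) := by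
    rw [real_inner_self_eq_norm_sq, norm_diomV hk (hwd k hk hkj), one_pow]
  rw [← real_inner_smul_left]
  obtain _ | _ | k := k
  · omega
  · rw [zero_add] at hv ⊢
    rw [diomU_smul_diomP_one hwd hkj, hv]
  · rw [diomU_smul_diomP_succ hA hm hwd (by omega) hkj, inner_sub_left, real_inner_smul_left, hv,
      inner_diomP_diomV_eq_zero hA hm hwd (by omega) (by omega) (by omega) (by omega), mul_zero,
      sub_zero]

/-- `p_kᵀ A p_k = 1 / u_{k,k}`. -/
theorem diomU_mul_inner_diomP (hA : A.IsSymm) (hm : 2 ≤ m)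
    (hwd : DIOMWellDefined A b x₀ m j) {k : ℕ} (hk : 1 ≤ k) (hkj : k ≤ j) :
    diomU A b x₀ m k k *
      inner ℝ (diomP A b x₀ m k) (A.toEuclideanLin (diomP A b x₀ m k)) = 1 := by
  rw [toEuclideanLin_diomP hA hm hwd hk hkj, inner_add_right, real_inner_smul_right,
    inner_diomP_diomV_eq_zero hA hm hwd (l := k + 1) hk (by omega) hkj (by omega), mul_zero,
    add_zero, diomU_mul_inner_diomP_diomV hA hm hwd hk hkj]

theorem diomZeta_succ {k : ℕ} (hk : 1 ≤ k) :
    diomZeta A b x₀ m (k + 1) = -diomL A b x₀ m k * diomZeta A b x₀ m k := by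
  obtain ⟨k, rfl⟩ : ∃ q, k = q + 1 := ⟨k - 1, by omega⟩
  rw [diomZeta]

theorem diomZeta_one_smul_diomV :
    diomZeta A b x₀ m 1 • diomV A b x₀ m 1 = b - A.toEuclideanLin x₀ := by
  rw [diomZeta, diomV, smul_smul]
  by_cases h : b - A.toEuclideanLin x₀ = 0
  · simp [h]
  · rw [mul_inv_cancel₀ (norm_ne_zero_iff.2 h), one_smul]

theorem diomZeta_ne_zero (hwd : DIOMWellDefined A b x₀ m j) {k : ℕ} (hk : 1 ≤ k)
    (hkj : k ≤ j) : diomZeta A b x₀ m k ≠ 0 := by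
  induction k, hk using Nat.le_induction with
  | base =>
    intro h0
    rw [diomZeta, norm_eq_zero] at h0
    refine diomV_ne_zero le_rfl (hwd 1 le_rfl hkj) ?_
    rw [diomV, h0, smul_zero]
  | succ k hk ih =>
    rw [diomZeta_succ hk, diomL]
    exact mul_ne_zero (neg_ne_zero.2 (div_ne_zero (diomT_succ_self_ne_zero hwd hk hkj)
      (diomU_self_ne_zero hwd hk (by omega)))) (ih (by omega))

/-! ### Comparison with conjugate gradients -/

theorem rho_one (s : PCGState n) : s.rho 1 = inner ℝ s.g s.g := by
  simp [PCGState.rho]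

/-- The conjugate gradient residual is a multiple of a Lanczos vector and the conjugate gradient
direction is a multiple of the DIOM direction; the multiples give `gᵀ g = ζ²` and
`dᵀ A d = ζ² u`. -/
theorem rho_eq_and_curv_eq (hA : A.IsSymm) (hm : 2 ≤ m) (hwd : DIOMWellDefined A b x₀ m j)
    {k : ℕ} (hk : 1 ≤ k) (hkj : k ≤ j) {s : PCGState n}
    (hg : s.g = -diomZeta A b x₀ m k • diomV A b x₀ m k)
    (hd : s.d = (diomZeta A b x₀ m k * diomU A b x₀ m k k) • diomP A b x₀ m k) :
    s.rho 1 = diomZeta A b x₀ m k ^ 2 ∧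
      s.curv A = diomZeta A b x₀ m k ^ 2 * diomU A b x₀ m k k := by
  constructor
  · rw [rho_one, hg, real_inner_smul_left, real_inner_smul_right, real_inner_self_eq_norm_sq,
      norm_diomV hk (hwd k hk hkj)]
    ring
  · rw [PCGState.curv, hd, map_smul, real_inner_smul_left, real_inner_smul_right]
    linear_combination diomZeta A b x₀ m k ^ 2 * diomU A b x₀ m k k *
      diomU_mul_inner_diomP hA hm hwd hk hkj

/-- The step length is `α = 1 / u_{k,k}`, so the conjugate gradient step is `ζ_k p_k`. -/
theorem alpha_smul_eq (hA : A.IsSymm) (hm : 2 ≤ m) (hwd : DIOMWellDefined A b x₀ m j)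
    {k : ℕ} (hk : 1 ≤ k) (hkj : k ≤ j) {s : PCGState n}
    (hg : s.g = -diomZeta A b x₀ m k • diomV A b x₀ m k)
    (hd : s.d = (diomZeta A b x₀ m k * diomU A b x₀ m k k) • diomP A b x₀ m k) :
    (s.rho 1 / s.curv A) • s.d = diomZeta A b x₀ m k • diomP A b x₀ m k := by
  have hu := diomU_self_ne_zero hwd hk hkj
  have hz := diomZeta_ne_zero hwd hk hkj
  obtain ⟨h₁, h₂⟩ := rho_eq_and_curv_eq hA hm hwd hk hkj hg hd
  rw [h₁, h₂, hd, smul_smul]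
  congr 1
  field_simp

theorem pcgStep_x (hA : A.IsSymm) (hm : 2 ≤ m) (hwd : DIOMWellDefined A b x₀ m j)
    {k : ℕ} (hk : 1 ≤ k) (hkj : k ≤ j) {s : PCGState n}
    (hg : s.g = -diomZeta A b x₀ m k • diomV A b x₀ m k)
    (hd : s.d = (diomZeta A b x₀ m k * diomU A b x₀ m k k) • diomP A b x₀ m k) :
    (pcgStep A 1 s).x = s.x + diomZeta A b x₀ m k • diomP A b x₀ m k := by
  rw [← alpha_smul_eq hA hm hwd hk hkj hg hd]
  rfl

theorem pcgStep_g (hA : A.IsSymm) (hm : 2 ≤ m) (hwd : DIOMWellDefined A b x₀ m j)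
    {k : ℕ} (hk : 1 ≤ k) (hkj : k ≤ j) {s : PCGState n}
    (hg : s.g = -diomZeta A b x₀ m k • diomV A b x₀ m k)
    (hd : s.d = (diomZeta A b x₀ m k * diomU A b x₀ m k k) • diomP A b x₀ m k) :
    (pcgStep A 1 s).g = -diomZeta A b x₀ m (k + 1) • diomV A b x₀ m (k + 1) := by
  change s.g + (s.rho 1 / s.curv A) • A.toEuclideanLin s.d = _
  rw [← map_smul, alpha_smul_eq hA hm hwd hk hkj hg hd, map_smul,
    toEuclideanLin_diomP hA hm hwd hk hkj, hg, diomZeta_succ hk]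
  module

theorem pcgStep_d (hA : A.IsSymm) (hm : 2 ≤ m) (hwd : DIOMWellDefined A b x₀ m j)
    {k : ℕ} (hk : 1 ≤ k) (hkj : k + 1 ≤ j) {s : PCGState n}
    (hg : s.g = -diomZeta A b x₀ m k • diomV A b x₀ m k)
    (hd : s.d = (diomZeta A b x₀ m k * diomU A b x₀ m k k) • diomP A b x₀ m k) :
    (pcgStep A 1 s).d = (diomZeta A b x₀ m (k + 1) * diomU A b x₀ m (k + 1) (k + 1)) •
      diomP A b x₀ m (k + 1) := by
  have hz := diomZeta_ne_zero hwd hk (by omega)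
  have hg' := pcgStep_g hA hm hwd hk (by omega) hg hd
  have hρ : (pcgStep A 1 s).rho 1 = diomZeta A b x₀ m (k + 1) ^ 2 := by
    rw [rho_one, hg', real_inner_smul_left, real_inner_smul_right, real_inner_self_eq_norm_sq,
      norm_diomV (by omega) (hwd (k + 1) (by omega) hkj)]
    ring
  have hd' : (pcgStep A 1 s).d = -(pcgStep A 1 s).g +
      ((pcgStep A 1 s).rho 1 / s.rho 1) • s.d := by
    have h1 : ∀ v : EuclideanSpace ℝ (Fin n),
        (1 : Matrix (Fin n) (Fin n) ℝ).toEuclideanLin v = v := fun v => by simp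
    simp only [pcgStep, PCGState.rho, h1]
  -- `β = ℓ_{k+1,k}²`
  have hβ : (pcgStep A 1 s).rho 1 / s.rho 1 = diomL A b x₀ m k ^ 2 := by
    rw [hρ, (rho_eq_and_curv_eq hA hm hwd hk (by omega) hg hd).1, diomZeta_succ hk]
    field_simp
  rw [hd', hβ, hg', hd, mul_smul (diomZeta A b x₀ m (k + 1)),
    diomU_smul_diomP_succ hA hm hwd hk hkj, diomZeta_succ hk,
    ← diomL_mul_diomU hwd hk (by omega)]
  module

theorem pcg_g_d_eq (hA : A.IsSymm) (hm : 2 ≤ m) (hwd : DIOMWellDefined A b x₀ m j)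
    {k : ℕ} (hk : k < j) :
    (pcg A 1 b x₀ k).g = -diomZeta A b x₀ m (k + 1) • diomV A b x₀ m (k + 1) ∧
    (pcg A 1 b x₀ k).d = (diomZeta A b x₀ m (k + 1) * diomU A b x₀ m (k + 1) (k + 1)) •
      diomP A b x₀ m (k + 1) := by
  induction k with
  | zero =>
    constructor
    · rw [zero_add, neg_smul, diomZeta_one_smul_diomV, neg_sub]
      rfl
    · rw [zero_add, mul_smul, diomU_smul_diomP_one hwd (by omega), diomZeta_one_smul_diomV]
      simp [pcg, pcgInit]
  | succ k ih =>
    obtain ⟨hg, hd⟩ := ih (by omega)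
    exact ⟨pcgStep_g hA hm hwd (by omega) (by omega) hg hd,
      pcgStep_d hA hm hwd (by omega) (by omega) hg hd⟩

end

end Krylov

end

theorem proposition5p4 (n : ℕ) (A : Matrix (Fin n) (Fin n) ℝ) (hA : A.IsSymm)
    (b x₀ : EuclideanSpace ℝ (Fin n)) (m : ℕ) (hm : 2 ≤ m) (j : ℕ)
    (hwd : Krylov.DIOMWellDefined A b x₀ m j) :
    (∀ k < j, (Krylov.pcg A 1 b x₀ k).rho 1 ≠ 0 ∧ (Krylov.pcg A 1 b x₀ k).curv A ≠ 0) ∧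
    (∀ k ≤ j, Krylov.diomX A b x₀ m k = (Krylov.pcg A 1 b x₀ k).x) := by
  constructor
  · intro k hk
    obtain ⟨hg, hd⟩ := Krylov.pcg_g_d_eq hA hm hwd hk
    obtain ⟨hρ, hc⟩ := Krylov.rho_eq_and_curv_eq hA hm hwd (by omega) (by omega) hg hd
    have hz := Krylov.diomZeta_ne_zero hwd (by omega : 1 ≤ k + 1) hk
    have hu := Krylov.diomU_self_ne_zero hwd (by omega : 1 ≤ k + 1) hk
    rw [hρ, hc]
    exact ⟨pow_ne_zero 2 hz, mul_ne_zero (pow_ne_zero 2 hz) hu⟩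
  · intro k hk
    induction k with
    | zero => rfl
    | succ k ih =>
      obtain ⟨hg, hd⟩ := Krylov.pcg_g_d_eq hA hm hwd (by omega : k < j)
      rw [Krylov.diomX, ih (by omega)]
      exact (Krylov.pcgStep_x hA hm hwd (by omega) hk hg hd).symm
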